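/- **Setting.** Let $\mathbb{F}_q$ be a finite field, $n$ a positive integer with $\gcd(4n,q)=1$, and let $Q_{4n}=\langle x,y\mid x^{2n}=1,\ y^2=x^n,\ yxy^{-1}=x^{-1}\rangle$. For a polynomial $g$ with $g(0)\neq 0$ put $g^*(x)=g(0)^{-1}x^{\deg g}g(x^{-1})$. Let $$x^n-1=f_1\cdots f_r\, f_{r+1}f_{r+1}^*\cdots f_{r+s}f_{r+s}^*,\qquad x^n+1=g_1\cdots g_t\, g_{t+1}g_{t+1}^*\cdots g_{t+k}g_{t+k}^*$$ be the factorizations into monic irreducible polynomials over $\mathbb{F}_q$, where $f_j=f_j^*$ for $j\le r$ and $g_i=g_i^*$ for $i\le t$, ordered such that $f_1=x-1$, $f_2=x+1$ if $n$ is even, and $f_1=x-1$, $g_1=x+1$ if $n$ is odd. Put $\delta(n)=2,\ \mu(n)=0$ if $n$ is even and $\delta(n)=1,\ \mu(n)=1$ if $n$ is odd. Let $\alpha_j$ be a root of $f_j$ and $\beta_i$ a root of $g_i$ in some extension field of $\mathbb{F}_q$. Let $F_j$ be $\mathbb{F}_q$ for $j\le\delta(n)$, $\mathbb{F}_q[\alpha_j+\alpha_j^{-1}]$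 for $\delta(n)<j\le r$, and $\mathbb{F}_q[\alpha_j]$ for $j>r$; let $L_i$ be $\mathbb{F}_q$ for $i\le\mu(n)$, $\mathbb{F}_q[\beta_i+\beta_i^{-1}]$ for $\mu(n)<i\le t$, and $\mathbb{F}_q[\beta_i]$ for $i>t$. Put $$A_j=\begin{cases}\mathbb{F}_q\oplus\mathbb{F}_q & j\le\delta(n),\\ \mathrm{Mat}_2(F_j)& j>\delta(n),\end{cases}\qquad B_i=\begin{cases}\mathbb{F}_q\oplus\mathbb{F}_q & i\le\mu(n),\ q\equiv 1 \pmod 4,\\ \mathbb{F}_q[\sqrt{-1}]\cong\mathbb{F}_{q^2} & i\le\mu(n),\ q\equiv 3\pmod 4,\\ \mathrm{Mat}_2(L_i)& i>\mu(n).\end{cases}$$ For $j>\delta(n)$ let $$I_j(u,v)=\left\{\begin{pmatrix} av&-au\\ bv&-bu\end{pmatrix}: a,b\in F_j\right\},$$ and for $i>\mu(n)$ let $J_i(u,v)$ be the same with $L_i$ in place of $F_j$. Thus $I_j(0,1)$ and $I_j(1,0)$ are the left ideals of matrices supported in the first and in the second column, respectively. Call an isomorphism of $\mathbb{F}_q$-algebras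 $\rho:\mathbb{F}_q[Q_{4n}]\to\bigoplus_{j=1}^{r+s}A_j\oplus\bigoplus_{i=1}^{t+k}B_i$, with components $\tau_j$ and $\eta_i$, *standard* if * for $j\le\delta(n)$: $f_j(\tau_j(x))=0$ and $\tau_j(y)=(1,-1)$; * for $\delta(n)<j\le r$: $f_j(\tau_j(x))=0$; * for $j>r$: $\tau_j(x)=\mathrm{diag}(\alpha_j,\alpha_j^{-1})$ and $\tau_j(y)=\begin{pmatrix}0&1\\1&0\end{pmatrix}$; * for $i\le\mu(n)$: $g_i(\eta_i(x))=0$, and $\eta_i(y)=(\iota,-\iota)$ for some $\iota\in\mathbb{F}_q$ with $\iota^2=-1$ if $q\equiv1\pmod 4$, while $\eta_i(y)=\sqrt{-1}$ if $q\equiv 3\pmod 4$; * for $\mu(n)<i\le t$: $g_i(\eta_i(x))=0$; * for $i>t$: $\eta_i(x)=\mathrm{diag}(\beta_i,\beta_i^{-1})$ and $\eta_i(y)=\begin{pmatrix}0&-1\\1&0\end{pmatrix}$. **Theorem.** A standard isomorphism $\rho$ exists. Let $\rho$ be any standard isomorphism, $\ell$ a positive divisor of $2n$, and $h\in\mathbb{F}_q[\hat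 x]$. Let $\hat C_h=(h)$ be the cyclic code generated by $h$ in $\mathbb{F}_q[\hat x]/(\hat x^{2n/\ell}-1)$, let $\Omega:\mathbb{F}_q[\hat x]/(\hat x^{2n/\ell}-1)\to\mathbb{F}_q[Q_{4n}]$ be the algebra homomorphism with $\hat x\mapsto x^\ell$, and let $C=\mathbb{F}_q[Q_{4n}]\,\Omega(\hat C_h)$ be the induced code. Then $$\rho(C)=\bigoplus_{j=1}^{r+s}C_j\oplus\bigoplus_{i=1}^{t+k}C_i',$$ $$C_j=\begin{cases}A_j& j\in S_1,\\ I_j(0,1)& j\in S_2,\\ I_j(1,0)& j\in S_3,\\ 0& \text{otherwise,}\end{cases}\qquad C'_i=\begin{cases}B_i& i\in S_4,\\ J_i(0,1)& i\in S_5,\\ J_i(1,0)& i\in S_6,\\ 0&\text{otherwise,}\end{cases}$$ where $$\begin{aligned} S_1&=\{1\le j\le r+s: f_j(x)\nmid h(x^\ell),\ f_j^*(x)\nmid h(x^\ell)\},\\ S_2&=\{\delta(n)<j\le r+s: f_j(x)\nmid h(x^\ell),\ f_j^*(x)\mid h(x^\ell)\},\\ S_3&=\{\delta(n)<j\le r+s: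 f_j(x)\mid h(x^\ell),\ f_j^*(x)\nmid h(x^\ell)\},\\ S_4&=\{1\le i\le t+k: g_i(x)\nmid h(x^\ell),\ g_i^*(x)\nmid h(x^\ell)\},\\ S_5&=\{\mu(n)<i\le t+k: g_i(x)\nmid h(x^\ell),\ g_i^*(x)\mid h(x^\ell)\},\\ S_6&=\{\mu(n)<i\le t+k: g_i(x)\mid h(x^\ell),\ g_i^*(x)\nmid h(x^\ell)\}. \end{aligned}$$ -/

import Mathlib

open Polynomial

universe u v

/-! ### The generalized quaternion group algebra and induced cyclic codes -/

/-- The group algebra `F[Q_{4n}]`, with `Q_{4n} = ⟨x, y | x^{2n} = 1, y² = xⁿ, y x y⁻¹ = x⁻¹⟩`. -/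
abbrev QAlg (F : Type u) [Field F] (n : ℕ) : Type u := MonoidAlgebra F (QuaternionGroup n)

/-- The generator `x` of order `2n`, as an element of the group algebra. -/
noncomputable def qx (F : Type u) [Field F] (n : ℕ) : QAlg F n :=
  MonoidAlgebra.of F (QuaternionGroup n) (QuaternionGroup.a 1)

/-- The generator `y`, as an element of the group algebra. -/
noncomputable def qy (F : Type u) [Field F] (n : ℕ) : QAlg F n :=
  MonoidAlgebra.of F (QuaternionGroup n) (QuaternionGroup.xa 0)

theorem qx_pow_two_mul (F : Type u) [Field F] (n : ℕ) : qx F n ^ (2 * n) = 1 := by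
  rw [qx, ← map_pow, QuaternionGroup.a_one_pow_n, map_one]

/-- The cyclic group algebra `F[x̂]/(x̂^m - 1)`. -/
abbrev CyclicAlg (F : Type u) [Field F] (m : ℕ) : Type u :=
  F[X] ⧸ Ideal.span {(X ^ m - 1 : F[X])}

/-- The embedding `Ω : F[x̂]/(x̂^{2n/ℓ} - 1) → F[Q_{4n}]`, `x̂ ↦ x^ℓ`, for a divisor `ℓ` of `2n`. -/
noncomputable def Omega (F : Type u) [Field F] (n l : ℕ) (hl : l ∣ 2 * n) :
    CyclicAlg F (2 * n / l) →ₐ[F] QAlg F n :=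
  Ideal.Quotient.liftₐ _ (aeval (qx F n ^ l)) (by
    intro p hp
    obtain ⟨c, rfl⟩ := Ideal.mem_span_singleton'.1 hp
    simp [← pow_mul, Nat.mul_div_cancel' hl, qx_pow_two_mul])

/-- The cyclic code `Ĉ_h = (h)` in `F[x̂]/(x̂^m - 1)`. -/
noncomputable def cyclicCode (F : Type u) [Field F] (m : ℕ) (h : F[X]) : Ideal (CyclicAlg F m) :=
  Ideal.span {Ideal.Quotient.mk _ h}

/-- The code `F[Q_{4n}] Ω(Ĉ_h)` induced by `Ĉ_h`: the left ideal generated by `Ω(Ĉ_h)`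
(`Ideal` means left ideal over a noncommutative ring). -/
noncomputable def inducedCode (F : Type u) [Field F] (n l : ℕ) (hl : l ∣ 2 * n) (h : F[X]) :
    Ideal (QAlg F n) :=
  Ideal.span (Omega F n l hl '' (cyclicCode F (2 * n / l) h : Set (CyclicAlg F (2 * n / l))))

/-! ### Factorization of `x^n - 1` and `x^n + 1` -/

/-- The (monic) reciprocal polynomial `g^*(x) = g(0)⁻¹ x^{deg g} g(x⁻¹)`. -/
noncomputable def recip {F : Type u} [Field F] (g : F[X]) : F[X] :=
  C (g.coeff 0)⁻¹ * g.reverse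

/-- `δ(n)`. -/
def delta (n : ℕ) : ℕ := if Even n then 2 else 1

/-- `μ(n)`. -/
def mu (n : ℕ) : ℕ := if Even n then 0 else 1

/-- The factorizations
`x^n - 1 = f_1 ⋯ f_r · f_{r+1} f_{r+1}^* ⋯ f_{r+s} f_{r+s}^*` and
`x^n + 1 = g_1 ⋯ g_t · g_{t+1} g_{t+1}^* ⋯ g_{t+k} g_{t+k}^*` into monic irreducible factors, with
the self-reciprocal ones first. Indices are shifted to start at `0`, so that the factor `f_j` is
`f ⟨j - 1, _⟩`. -/
structure IsQFactorization {F : Type u} [Field F] (n r s t k : ℕ)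
    (f : Fin (r + s) → F[X]) (g : Fin (t + k) → F[X]) : Prop where
  f_monic : ∀ j, (f j).Monic
  g_monic : ∀ i, (g i).Monic
  f_irreducible : ∀ j, Irreducible (f j)
  g_irreducible : ∀ i, Irreducible (g i)
  f_recip_irreducible : ∀ j, Irreducible (recip (f j))
  g_recip_irreducible : ∀ i, Irreducible (recip (g i))
  f_self : ∀ j : Fin (r + s), j.val < r → recip (f j) = f j
  g_self : ∀ i : Fin (t + k), i.val < t → recip (g i) = g i
  f_prod : (X ^ n - 1 : F[X]) = ∏ j, if j.val < r then f j else f j * recip (f j)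
  g_prod : (X ^ n + 1 : F[X]) = ∏ i, if i.val < t then g i else g i * recip (g i)
  delta_le : delta n ≤ r
  mu_le : mu n ≤ t
  f_first : ∀ j : Fin (r + s), j.val = 0 → f j = X - 1
  f_second : Even n → ∀ j : Fin (r + s), j.val = 1 → f j = X + 1
  g_first : Odd n → ∀ i : Fin (t + k), i.val = 0 → g i = X + 1

/-! ### The Wedderburn blocks -/

/-- The kinds of blocks that occur in the decomposition of `F[Q_{4n}]`. -/
inductive BlockKind
  /-- `L ⊕ L` -/
  | split
  /-- the quadratic extension `L[√-1]` -/
  | quad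
  /-- `Mat₂(L)`, belonging to a self-reciprocal factor -/
  | matSelf
  /-- `Mat₂(L)`, belonging to a pair of distinct reciprocal factors -/
  | matPair

/-- The block over `L` of a given kind. -/
def Block {F : Type u} {K : Type v} [Field F] [Field K] [Algebra F K] (L : IntermediateField F K) :
    BlockKind → Type v
  | .split => L × L
  | .quad => AdjoinRoot (X ^ 2 + 1 : L[X])
  | .matSelf => Matrix (Fin 2) (Fin 2) L
  | .matPair => Matrix (Fin 2) (Fin 2) L

noncomputable instance {F : Type u} {K : Type v} [Field F] [Field K] [Algebra F K]
    (L : IntermediateField F K) : (κ : BlockKind) → Ring (Block L κ)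
  | .split => inferInstanceAs (Ring (L × L))
  | .quad => inferInstanceAs (Ring (AdjoinRoot (X ^ 2 + 1 : L[X])))
  | .matSelf => inferInstanceAs (Ring (Matrix (Fin 2) (Fin 2) L))
  | .matPair => inferInstanceAs (Ring (Matrix (Fin 2) (Fin 2) L))

noncomputable instance {F : Type u} {K : Type v} [Field F] [Field K] [Algebra F K]
    (L : IntermediateField F K) : (κ : BlockKind) → Algebra F (Block L κ)
  | .split => inferInstanceAs (Algebra F (L × L))
  | .quad => inferInstanceAs (Algebra F (AdjoinRoot (X ^ 2 + 1 : L[X])))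
  | .matSelf => inferInstanceAs (Algebra F (Matrix (Fin 2) (Fin 2) L))
  | .matPair => inferInstanceAs (Algebra F (Matrix (Fin 2) (Fin 2) L))

/-- The matrices `(a y, -a x; b y, -b x)` with `a, b ∈ L`. -/
def matLine {F : Type u} {K : Type v} [Field F] [Field K] [Algebra F K]
    (L : IntermediateField F K) (x y : L) : Submodule F (Matrix (Fin 2) (Fin 2) L) where
  carrier := {z | ∃ a b : L, z = !![a * y, -(a * x); b * y, -(b * x)]}
  zero_mem' := ⟨0, 0, by ext i j; fin_cases i <;> fin_cases j <;> simp⟩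
  add_mem' := by
    rintro _ _ ⟨a, b, rfl⟩ ⟨a', b', rfl⟩
    exact ⟨a + a', b + b', by ext i j; fin_cases i <;> fin_cases j <;> simp <;> ring⟩
  smul_mem' := by
    rintro c _ ⟨a, b, rfl⟩
    exact ⟨c • a, c • b, by ext i j; fin_cases i <;> fin_cases j <;> simp⟩

/-- The pairs `(a x, b y)` with `a, b ∈ L`. -/
def splitLine {F : Type u} {K : Type v} [Field F] [Field K] [Algebra F K]
    (L : IntermediateField F K) (x y : L) : Submodule F (L × L) where
  carrier := {z | ∃ a b : L, z = (a * x, b * y)}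
  zero_mem' := ⟨0, 0, by simp [Prod.ext_iff]⟩
  add_mem' := by
    rintro _ _ ⟨a, b, rfl⟩ ⟨a', b', rfl⟩
    exact ⟨a + a', b + b', by simp [add_mul]⟩
  smul_mem' := by
    rintro c _ ⟨a, b, rfl⟩
    exact ⟨c • a, c • b, by simp⟩

/-- The left ideals `I_j(x, y)`, respectively `J_i(x, y)`, of a block. A block of kind `quad` is a
field and has no such ideals; the value there is a convention that is never used. -/
noncomputable def lineIdeal {F : Type u} {K : Type v} [Field F] [Field K] [Algebra F K]
    (L : IntermediateField F K) : (κ : BlockKind) → (x y : L) → Submodule F (Block L κ)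
  | .split, x, y => splitLine L x y
  | .quad, _, _ => (⊥ : Submodule F (AdjoinRoot (X ^ 2 + 1 : L[X])))
  | .matSelf, x, y => matLine L x y
  | .matPair, x, y => matLine L x y

open scoped Classical in
/-- The field attached to the factor number `j` (counted from `0`) with root `α`: it is `F` for
`j < d`, `F[α + α⁻¹]` for `d ≤ j < r`, and `F[α]` for `r ≤ j`. With `d = δ(n)` this gives `F_j`,
and for the factors of `x^n + 1` with `d = μ(n)` it gives `L_i`. -/
noncomputable def blockField (F : Type u) {K : Type v} [Field F] [Field K] [Algebra F K]
    (d r : ℕ) (j : ℕ) (α : K) : IntermediateField F K :=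
  if j < d then ⊥
  else if j < r then IntermediateField.adjoin F {α + α⁻¹}
  else IntermediateField.adjoin F {α}

/-- The kind of the block `A_j`. -/
def kindA (n r : ℕ) (j : ℕ) : BlockKind :=
  if j < delta n then .split else if j < r then .matSelf else .matPair

/-- The kind of the block `B_i`. For `n` odd, the block of the factor `x + 1` is `F[y]/(y² + 1)`,
which is `F ⊕ F` if `q ≡ 1 (mod 4)` and the field `F[√-1]` if `q ≡ 3 (mod 4)`. -/
def kindB (q n t : ℕ) (i : ℕ) : BlockKind :=
  if i < mu n then (if q % 4 = 1 then .split else .quad)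
  else if i < t then .matSelf else .matPair

/-- The block `A_j` (over `F_j`). -/
abbrev ABlock (F : Type u) {K : Type v} [Field F] [Field K] [Algebra F K] (n r s : ℕ)
    (α : Fin (r + s) → K) (j : Fin (r + s)) : Type v :=
  Block (blockField F (delta n) r j (α j)) (kindA n r j)

/-- The block `B_i` (over `L_i`). -/
abbrev BBlock (F : Type u) {K : Type v} [Field F] [Field K] [Algebra F K] (n t k : ℕ)
    (β : Fin (t + k) → K) (i : Fin (t + k)) : Type v :=
  Block (blockField F (mu n) t i (β i)) (kindB (Nat.card F) n t i)

/-- The requirement on the images `ξ` of `x` and `η` of `y` in the block that belongs to the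
factor `p` with root `α`; `ε = 1` for the factors of `x^n - 1`, `ε = -1` for those of `x^n + 1`.
* In `L ⊕ L`: `p(ξ) = 0` and `η = (ι, -ι)` with `ι² = ε`, where `ι = 1` if `ε = 1`.
* In `L[√-1]`: `p(ξ) = 0` and `η = √-1`.
* In `Mat₂(L)`, for `p` self-reciprocal: `p(ξ) = 0` (any choice of basis of the representation).
* In `Mat₂(L)`, for `p ≠ p^*`: `ξ = diag(α, α⁻¹)` and `η = (0, ε; 1, 0)`. -/
def IsStandardImage {F : Type u} {K : Type v} [Field F] [Field K] [Algebra F K]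
    (L : IntermediateField F K) (ε : ℤ) (p : F[X]) (α : K) :
    (κ : BlockKind) → (ξ η : Block L κ) → Prop
  | .split, ξ, η => aeval (ξ : L × L) p = 0 ∧
      ∃ ι : L, ι ^ 2 = (ε : L) ∧ (ε = 1 → ι = 1) ∧ (η : L × L) = (ι, -ι)
  | .quad, ξ, η => aeval (ξ : AdjoinRoot (X ^ 2 + 1 : L[X])) p = 0 ∧
      (η : AdjoinRoot (X ^ 2 + 1 : L[X])) = AdjoinRoot.root _
  | .matSelf, ξ, _ => aeval (ξ : Matrix (Fin 2) (Fin 2) L) p = 0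
  | .matPair, ξ, η =>
      (ξ : Matrix (Fin 2) (Fin 2) L).map (algebraMap L K) = !![α, 0; 0, α⁻¹] ∧
      (η : Matrix (Fin 2) (Fin 2) L) = !![0, (ε : L); 1, 0]

/-- An isomorphism `ρ : F[Q_{4n}] → (⊕ A_j) ⊕ (⊕ B_i)` of `F`-algebras whose components send `x`
and `y` to the standard elements of the blocks. -/
structure IsWedderburnMap {F : Type u} {K : Type v} [Field F] [Field K] [Algebra F K]
    (n r s t k : ℕ) (f : Fin (r + s) → F[X]) (g : Fin (t + k) → F[X])
    (α : Fin (r + s) → K) (β : Fin (t + k) → K)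
    (ρ : QAlg F n ≃ₐ[F] ((j : Fin (r + s)) → ABlock F n r s α j) ×
      ((i : Fin (t + k)) → BBlock F n t k β i)) : Prop where
  f_image : ∀ j, IsStandardImage _ 1 (f j) (α j) (kindA n r j)
    ((ρ (qx F n)).1 j) ((ρ (qy F n)).1 j)
  g_image : ∀ i, IsStandardImage _ (-1) (g i) (β i) (kindB (Nat.card F) n t i)
    ((ρ (qx F n)).2 i) ((ρ (qy F n)).2 i)

/-! ### The blocks of the induced code -/

/-- The indices `j` with
`f_j(x) ∤ h(x^ℓ)` and `f_j^*(x) ∤ h(x^ℓ)`. This is `S_1`, and `S_4` for the factors `g_i`. -/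
def setBoth {F : Type u} [Field F] {m : ℕ} (f : Fin m → F[X]) (l : ℕ) (h : F[X]) : Set (Fin m) :=
  {j | ¬ f j ∣ h.comp (X ^ l) ∧ ¬ recip (f j) ∣ h.comp (X ^ l)}

/-- The indices `j` beyond the first `d` with `f_j(x) ∤ h(x^ℓ)` and `f_j^*(x) ∣ h(x^ℓ)`. This is
`S_2` for `d = δ(n)`, and `S_5` for the factors `g_i` and `d = μ(n)`. -/
def setFst {F : Type u} [Field F] {m : ℕ} (d : ℕ) (f : Fin m → F[X]) (l : ℕ) (h : F[X]) :
    Set (Fin m) :=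
  {j | d ≤ j.val ∧ ¬ f j ∣ h.comp (X ^ l) ∧ recip (f j) ∣ h.comp (X ^ l)}

/-- The indices `j` beyond the first `d` with `f_j(x) ∣ h(x^ℓ)` and `f_j^*(x) ∤ h(x^ℓ)`. This is
`S_3` for `d = δ(n)`, and `S_6` for the factors `g_i` and `d = μ(n)`. -/
def setSnd {F : Type u} [Field F] {m : ℕ} (d : ℕ) (f : Fin m → F[X]) (l : ℕ) (h : F[X]) :
    Set (Fin m) :=
  {j | d ≤ j.val ∧ f j ∣ h.comp (X ^ l) ∧ ¬ recip (f j) ∣ h.comp (X ^ l)}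

open scoped Classical in
/-- The code block `C_j ⊆ A_j`. -/
noncomputable def codeBlockA {F : Type u} {K : Type v} [Field F] [Field K] [Algebra F K]
    (n r s : ℕ) (f : Fin (r + s) → F[X]) (α : Fin (r + s) → K) (l : ℕ) (h : F[X])
    (j : Fin (r + s)) : Submodule F (ABlock F n r s α j) :=
  if j ∈ setBoth f l h then ⊤
  else if j ∈ setFst (delta n) f l h then lineIdeal _ (kindA n r j) 0 1
  else if j ∈ setSnd (delta n) f l h then lineIdeal _ (kindA n r j) 1 0
  else ⊥

open scoped Classical in
/-- The code block `C'_i ⊆ B_i`. -/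
noncomputable def codeBlockB {F : Type u} {K : Type v} [Field F] [Field K] [Algebra F K]
    (n t k : ℕ) (g : Fin (t + k) → F[X]) (β : Fin (t + k) → K) (l : ℕ) (h : F[X])
    (i : Fin (t + k)) : Submodule F (BBlock F n t k β i) :=
  if i ∈ setBoth g l h then ⊤
  else if i ∈ setFst (mu n) g l h then lineIdeal _ (kindB (Nat.card F) n t i) 0 1
  else if i ∈ setSnd (mu n) g l h then lineIdeal _ (kindB (Nat.card F) n t i) 1 0
  else ⊥

/-! Since `yx = x⁻¹y`, every element of the group algebra is `P(x) + Q(x)y`, so a representation `x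
↦ ξ`, `y ↦ η` is governed by the pairs `P, Q` with `P(ξ) + Q(ξ)η = 0`. For a factor `p` with root `α
≠ α⁻¹`, the block is, over `K`, conjugate to `ξ = diag(α, α⁻¹)` and `η` antidiagonal, and the
relation forces `p` and `p*` to divide both `P` and `Q`. The blocks for `α = ±1` are treated by
hand, using that 2 is invertible.

Existence of `ρ`: if `P(x) + Q(x)y` dies in all blocks, then `x^n - 1` and `x^n + 1`, which are
separable and coprime, divide `P` and `Q`; hence so does `x^{2n} - 1` and the element is zero. Each
block has dimension at most twice the degree of its factor (`p`, or `p p*` for a pair), so the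
target has dimension at most `4n`, and the injection is bijective. The delicate case is a
self-reciprocal `p`: there the representation has to be realized over `F(α + α⁻¹)`, of degree at
most half that of `p` (`finrank_adjoin_add_inv_le`), and a suitable `η` exists because a binary
quadratic form over a finite field represents `±1` (`exists_sq_add_mul_add_sq`).

Shape of the code: with `H = h(x^ℓ)` the induced code is the left ideal generated by `H(x)`, so
under any standard `ρ` it is the product of the left ideals generated by the `H(ξ)`. If `p = p*`,
then `p(ξ) = 0` makes `H(ξ)` zero or invertible. For a pair, `H(ξ) = diag(H(α), H(α⁻¹))`, whose
entries vanish exactly when `p`, respectively `p*`, divides `H`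
(`IsStandardImage.exists_mul_eq_iff`). -/

/-! ### Reciprocal polynomials and the field `F(x + x⁻¹)` -/

section Recip
variable {F : Type u} [Field F]

theorem natDegree_recip {p : F[X]} (h0 : p.coeff 0 ≠ 0) : (recip p).natDegree = p.natDegree := by
  rw [recip, natDegree_C_mul (inv_ne_zero h0), reverse_natDegree,
    natTrailingDegree_eq_zero.2 (Or.inr h0), Nat.sub_zero]

theorem aeval_inv_recip {K : Type v} [Field K] [Algebra F K] {p : F[X]} {x : K} (hx : x ≠ 0)
    (hp : aeval x p = 0) : aeval x⁻¹ (recip p) = 0 := by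
  let := invertibleOfNonzero hx
  have := (eval₂_reverse_eq_zero_iff (algebraMap F K) x p).2 hp
  rw [invOf_eq_inv] at this
  rw [recip, map_mul, aeval_def x⁻¹ p.reverse, this, mul_zero]

theorem Irreducible.dvd_iff_aeval {K : Type v} [Field K] [Algebra F K] {p : F[X]}
    (hp : Irreducible p) {x : K} (hx : aeval x p = 0) (P : F[X]) : p ∣ P ↔ aeval x P = 0 := by
  constructor
  · rintro ⟨Q, rfl⟩
    rw [map_mul, hx, zero_mul]
  · intro h
    by_contra hn
    obtain ⟨a, b, hab⟩ := (hp.coprime_iff_not_dvd).2 hn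
    have := congrArg (aeval x) hab
    simp [hx, h] at this

/-- As `p` is self-reciprocal, `x ↦ x⁻¹` induces an automorphism of `F(x)` fixing `x + x⁻¹`. If `x +
x⁻¹` generated `F(x)`, the automorphism would be trivial, contrary to `x ≠ x⁻¹`; so the index is at
least 2. -/
theorem finrank_adjoin_add_inv_le {K : Type v} [Field K] [Algebra F K] {p : F[X]} (hm : p.Monic)
    (hp : Irreducible p) (hs : recip p = p) {x : K} (hx : aeval x p = 0) (h0 : x ≠ 0)
    (h1 : x ≠ x⁻¹) :
    2 * Module.finrank F (IntermediateField.adjoin F {x + x⁻¹}) ≤ p.natDegree := by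
  have hint : IsIntegral F x := ⟨p, hm, hx⟩
  have := IntermediateField.adjoin.finiteDimensional hint
  have hxm := IntermediateField.mem_adjoin_simple_self F x
  have hle : IntermediateField.adjoin F {x + x⁻¹} ≤ IntermediateField.adjoin F {x} := by
    rw [IntermediateField.adjoin_simple_le_iff]
    exact add_mem hxm (inv_mem hxm)
  have hdeg : Module.finrank F (IntermediateField.adjoin F {x}) = p.natDegree := by
    rw [IntermediateField.adjoin.finrank hint, ← minpoly.eq_of_irreducible_of_monic hp hx hm]
  obtain ⟨k, hk⟩ := IntermediateField.finrank_dvd_of_le_right hle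
  have hpos : 0 < p.natDegree := hp.natDegree_pos
  rw [← hdeg, hk, mul_comm]
  refine Nat.mul_le_mul_left _ ?_
  by_contra hlt
  have hk1 : k = 1 := by
    rcases Nat.eq_zero_or_pos k with h | h
    · rw [h, mul_zero] at hk
      omega
    · omega
  rw [hk1, mul_one] at hk
  have heq := IntermediateField.eq_of_le_of_finrank_eq hle hk.symm
  rw [← heq, IntermediateField.mem_adjoin_simple_iff] at hxm
  obtain ⟨R, S, hRS⟩ := hxm
  have hinv : aeval x⁻¹ p = 0 := hs ▸ aeval_inv_recip h0 hx
  obtain ⟨T, hT⟩ : ∃ T : F[X], x⁻¹ = aeval x T := by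
    have h2 : x⁻¹ ∈ Algebra.adjoin F {x} := by
      have := (IntermediateField.adjoin_simple_toSubalgebra_of_isAlgebraic hint.isAlgebraic).symm
      rw [this]
      exact (IntermediateField.adjoin F {x}).inv_mem (IntermediateField.mem_adjoin_simple_self F x)
    rw [Algebra.adjoin_singleton_eq_range_aeval] at h2
    obtain ⟨T, hT⟩ := h2
    exact ⟨T, hT.symm⟩
  -- Polynomial form of the automorphism: `x` and `x⁻¹` are roots of the same irreducible `p`, so
  -- they satisfy the same relations over `F`.
  have transfer : ∀ P : F[X], aeval x P = 0 → aeval x⁻¹ P = 0 := fun P h =>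
    (hp.dvd_iff_aeval hinv P).1 ((hp.dvd_iff_aeval hx P).2 h)
  have hT' : x = aeval x⁻¹ T := by
    have := transfer (X * T - 1) (by simp [← hT, h0])
    simp only [map_sub, map_mul, aeval_X, map_one, sub_eq_zero] at this
    exact (inv_mul_eq_one₀ h0).1 this
  -- A vanishing denominator would make the quotient 0 by convention, but `x ≠ 0`.
  have hS : aeval (x + x⁻¹) S ≠ 0 := by
    intro h
    rw [h, div_zero] at hRS
    exact h0 hRS
  -- The relation `x S(x + x⁻¹) = R(x + x⁻¹)`, made polynomial through `x⁻¹ = T(x)`, is carried to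
  -- `x⁻¹`; the argument `x + x⁻¹` is unchanged, so `x⁻¹ = R/S = x`.
  have key := transfer (X * S.comp (X + T) - R.comp (X + T)) (by
    rw [eq_div_iff hS] at hRS
    simp only [map_sub, map_mul, aeval_X, aeval_comp, map_add, ← hT, sub_eq_zero]
    exact hRS)
  simp only [map_sub, map_mul, aeval_X, aeval_comp, map_add, ← hT', sub_eq_zero] at key
  rw [add_comm x⁻¹ x, ← eq_div_iff hS, ← hRS] at key
  exact h1 key.symm

end Recip

/-! ### A binary quadratic form over a finite field -/

/-- Completing the square turns the form into `w² + (1 - c²/4) b²` with `w = a + cb/2`. It is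
nondegenerate since `c² ≠ 4`, and such a form over a finite field of odd order takes every value. -/
theorem exists_sq_add_mul_add_sq {L : Type v} [Field L] [Finite L] (h2 : (2 : L) ≠ 0) {c : L}
    (hc : c ^ 2 ≠ 4) (e : L) : ∃ a b : L, a ^ 2 + c * a * b + b ^ 2 = e := by
  cases nonempty_fintype L
  have hodd : Fintype.card L % 2 = 1 := FiniteField.odd_card_of_char_ne_two fun h =>
    h2 (by exact_mod_cast h ▸ ringChar.Nat.cast_ringChar (R := L))
  have hd : (1 - c ^ 2 / 4 : L) ≠ 0 := by
    intro h
    have h4 : (4 : L) ≠ 0 := by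
      have : (4 : L) = 2 * 2 := by norm_num
      rw [this]; exact mul_ne_zero h2 h2
    field_simp at h
    exact hc (by linear_combination -h)
  obtain ⟨w, b, h⟩ := FiniteField.exists_root_sum_quadratic (R := L) (f := X ^ 2)
    (g := C (1 - c ^ 2 / 4) * X ^ 2 + C 0 * X + C (-e)) (by simp) (degree_quadratic hd) hodd
  refine ⟨w - c / 2 * b, b, ?_⟩
  simp only [eval_add, eval_pow, eval_X, eval_mul, eval_C] at h
  have h4 : (4 : L) = 2 * 2 := by norm_num
  rw [h4] at h
  field_simp at h ⊢
  linear_combination h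

/-! ### Representations that are diagonal and antidiagonal over `K` -/

section Rep
variable {F : Type u} [Field F]

/-- Elements `ξ`, `η` of an algebra satisfying the relations of the generators of the generalized
quaternion group, with `ξ ^ n = ε`, such that the relations `P(ξ) + Q(ξ) η = 0` hold only if
`p` and its reciprocal divide `P` and `Q`. -/
structure IsBlockRep {A : Type v} [Ring A] [Algebra F A] (n : ℕ) (ε : ℤ) (p : F[X])
    (ξ η : A) : Prop where
  pow : ξ ^ n = (ε : A)
  sq : η ^ 2 = (ε : A)
  conj : ξ * η * ξ = η
  dvd : ∀ P Q : F[X], aeval ξ P + aeval ξ Q * η = 0 →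
    (p ∣ P ∧ recip p ∣ P) ∧ (p ∣ Q ∧ recip p ∣ Q)

variable {K : Type v} [Field K] [Algebra F K]

theorem aeval_diag (x y : K) (P : F[X]) :
    aeval (!![x, 0; 0, y] : Matrix (Fin 2) (Fin 2) K) P = !![aeval x P, 0; 0, aeval y P] := by
  have h : ∀ a b : K, (!![a, 0; 0, b] : Matrix (Fin 2) (Fin 2) K) =
      Matrix.diagonalAlgHom F ![a, b] := by
    intro a b
    ext i j
    change _ = Matrix.diagonal ![a, b] i j
    fin_cases i <;> fin_cases j <;> simp
  rw [h, h, aeval_algHom_apply]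
  congr 1
  funext i
  have := aeval_algHom_apply (Pi.evalAlgHom F (fun _ : Fin 2 => K) i) ![x, y] P
  rw [Pi.evalAlgHom_apply, Pi.evalAlgHom_apply] at this
  rw [← this]
  fin_cases i <;> simp

theorem SemiconjBy.aeval {A : Type v} [Ring A] [Algebra F A] {w a b : A} (h : SemiconjBy w a b)
    (P : F[X]) : SemiconjBy w (aeval a P) (aeval b P) := by
  induction P using Polynomial.induction_on' with
  | add P Q hP hQ => rw [map_add, map_add]; exact hP.add_right hQ
  | monomial n c =>
    rw [aeval_monomial, aeval_monomial]
    exact SemiconjBy.mul_right (Algebra.commutes c w).symm (h.pow_right n)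

section Matrices
variable {L : IntermediateField F K} {ξ η : Matrix (Fin 2) (Fin 2) L}
  {W : Matrix (Fin 2) (Fin 2) K} {x : K}

theorem mapMatrix_val_injective :
    Function.Injective (L.val.mapMatrix (m := Fin 2)) :=
  Matrix.map_injective Subtype.val_injective

theorem mul_mapMatrix_aeval
    (hξ : W * L.val.mapMatrix ξ = !![x, 0; 0, x⁻¹] * W) (P : F[X]) :
    W * L.val.mapMatrix (aeval ξ P) = !![aeval x P, 0; 0, aeval x⁻¹ P] * W := by
  have h : SemiconjBy W (L.val.mapMatrix ξ) !![x, 0; 0, x⁻¹] := hξ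
  have := h.aeval (F := F) P
  rw [aeval_diag, aeval_algHom_apply] at this
  exact this

theorem aeval_eq_zero_of_conj_diag (hW : IsUnit W)
    (hξ : W * L.val.mapMatrix ξ = !![x, 0; 0, x⁻¹] * W) {P : F[X]} (h : aeval x P = 0)
    (h' : aeval x⁻¹ P = 0) : aeval ξ P = 0 := by
  apply mapMatrix_val_injective
  apply hW.mul_left_cancel
  rw [mul_mapMatrix_aeval hξ, h, h', map_zero, mul_zero]
  ext i j
  fin_cases i <;> fin_cases j <;> simp [Matrix.mul_apply, Fin.sum_univ_two]

/-- Everything is checked over `K` after conjugation by `W`. There `P(ξ) + Q(ξ)η` has the entries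
`P(x)`, `a Q(x)`, `b Q(x⁻¹)`, `P(x⁻¹)`, and `a`, `b` are nonzero because `ab = ±1`. -/
theorem isBlockRep_of_conj_diag {n : ℕ} {ε : ℤ} {p : F[X]} (hp : Irreducible p)
    (hp' : Irreducible (recip p)) (hx : aeval x p = 0) (hx0 : x ≠ 0) (hpow : x ^ n = (ε : K))
    (hε : ε = 1 ∨ ε = -1)
    (hW : IsUnit W) (hξ : W * L.val.mapMatrix ξ = !![x, 0; 0, x⁻¹] * W) {a b : K}
    (hη : W * L.val.mapMatrix η = !![0, a; b, 0] * W) (hab : a * b = ε) :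
    IsBlockRep n ε p ξ η := by
  have hε0 : (ε : K) ≠ 0 := by rcases hε with rfl | rfl <;> simp
  have ha : a ≠ 0 := fun h => hε0 (by rw [← hab, h, zero_mul])
  have hb : b ≠ 0 := fun h => hε0 (by rw [← hab, h, mul_zero])
  have hpow' : x⁻¹ ^ n = (ε : K) := by
    rw [inv_pow, hpow]
    rcases hε with rfl | rfl <;> simp
  refine ⟨?_, ?_, ?_, ?_⟩
  · have := aeval_eq_zero_of_conj_diag (P := (X ^ n - (ε : F[X]))) hW hξ (by simp [hpow])
      (by simpa [sub_eq_zero] using hpow')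
    simpa [sub_eq_zero] using this
  · apply mapMatrix_val_injective
    apply hW.mul_left_cancel
    rw [map_pow, pow_two, ← mul_assoc, hη, mul_assoc, hη, ← mul_assoc, map_intCast]
    rw [(Int.cast_commute ε W).symm.eq]
    congr 1
    ext i j
    fin_cases i <;> fin_cases j <;>
      simp [Matrix.mul_apply, Fin.sum_univ_two, hab, mul_comm b a, Matrix.intCast_apply]
  · apply mapMatrix_val_injective
    apply hW.mul_left_cancel
    rw [map_mul, map_mul, ← mul_assoc, ← mul_assoc, hξ, mul_assoc _ W, hη, mul_assoc, mul_assoc, hξ,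
      ← mul_assoc, ← mul_assoc]
    congr 1
    ext i j
    fin_cases i <;> fin_cases j <;> simp [Matrix.mul_apply, Fin.sum_univ_two] <;> field_simp
  · intro P Q h
    have h2 := congrArg (fun M => W * L.val.mapMatrix M) h
    simp only [map_add, map_mul, mul_add, map_zero, mul_zero] at h2
    rw [← mul_assoc, mul_mapMatrix_aeval hξ, mul_mapMatrix_aeval hξ, mul_assoc, hη, ← mul_assoc,
      ← add_mul, ← zero_mul W] at h2
    have h3 := hW.mul_right_cancel h2
    have e00 := congrFun (congrFun h3 0) 0
    have e01 := congrFun (congrFun h3 0) 1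
    have e10 := congrFun (congrFun h3 1) 0
    have e11 := congrFun (congrFun h3 1) 1
    simp [ha, hb] at e00 e01 e10 e11
    have hx' := aeval_inv_recip hx0 hx
    rw [hp.dvd_iff_aeval hx, hp.dvd_iff_aeval hx, hp'.dvd_iff_aeval hx', hp'.dvd_iff_aeval hx']
    exact ⟨⟨e00, e11⟩, ⟨e01, e10⟩⟩

end Matrices
end Rep

/-! ### Standard representations in the four kinds of blocks -/

section StandardRep
variable {F : Type u} [Field F] {K : Type v} [Field K] [Algebra F K]

/-- The block `Block L κ` has dimension at most `D` and contains standard images of the generators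
that satisfy the quaternion relations and detect divisibility by `p` and its reciprocal. -/
def HasStandardRep (n : ℕ) (ε : ℤ) (p : F[X]) (x : K) (L : IntermediateField F K) (κ : BlockKind)
    (D : ℕ) : Prop :=
  Module.Finite F (Block L κ) ∧ Module.finrank F (Block L κ) ≤ D ∧
    ∃ ξ η : Block L κ, IsStandardImage L ε p x κ ξ η ∧ IsBlockRep n ε p ξ η

theorem hasStandardRep_matPair {n : ℕ} {ε : ℤ} (hε : ε = 1 ∨ ε = -1) {p : F[X]} (hm : p.Monic)
    (hp : Irreducible p) (hp' : Irreducible (recip p)) {x : K} (hx : aeval x p = 0) (hx0 : x ≠ 0)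
    (hpow : x ^ n = (ε : K)) :
    HasStandardRep n ε p x (IntermediateField.adjoin F {x}) .matPair (4 * p.natDegree) := by
  have hint : IsIntegral F x := ⟨p, hm, hx⟩
  have := IntermediateField.adjoin.finiteDimensional hint
  have hxm := IntermediateField.mem_adjoin_simple_self F x
  set L := IntermediateField.adjoin F {x} with hL
  have hfin : Module.Finite F (Matrix (Fin 2) (Fin 2) L) := inferInstance
  refine ⟨hfin, ?_, ?_⟩
  · have h1 : Module.finrank F L = p.natDegree := by
      rw [hL, IntermediateField.adjoin.finrank hint,
        ← minpoly.eq_of_irreducible_of_monic hp hx hm]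
    change Module.finrank F (Matrix (Fin 2) (Fin 2) L) ≤ _
    rw [Module.finrank_matrix, h1]
    simp
  · let z : L := ⟨x, hxm⟩
    let ξ : Matrix (Fin 2) (Fin 2) L := !![z, 0; 0, z⁻¹]
    let η : Matrix (Fin 2) (Fin 2) L := !![0, (ε : L); 1, 0]
    have hξ : ξ.map (algebraMap L K) = !![x, 0; 0, x⁻¹] := by
      ext i j
      fin_cases i <;> fin_cases j <;> simp [ξ, z]
    have hη : L.val.mapMatrix η = !![0, (ε : K); 1, 0] := by
      ext i j
      fin_cases i <;> fin_cases j <;> simp [η]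
    have hrep : IsBlockRep n ε p ξ η := by
      refine isBlockRep_of_conj_diag (W := 1) hp hp' hx hx0 hpow hε isUnit_one ?_ (a := ε) (b := 1)
        ?_ (mul_one _)
      · rw [one_mul, mul_one]; exact hξ
      · rw [one_mul, mul_one]; exact hη
    exact ⟨ξ, η, ⟨hξ, rfl⟩, hrep⟩

/-- `F(x)` is spanned by `1, x` over `L = F(x + x⁻¹)`, and `ξ` is the companion matrix of `T² - cT +
1`, with `c = x + x⁻¹`. The matrix `η` must invert `ξ` by conjugation and square to `ε`, which comes
down to writing `ε` as `(b + xa)(b + x⁻¹a)`, a value of the norm form. -/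
theorem hasStandardRep_matSelf [Finite F] (h2 : (2 : F) ≠ 0) {n : ℕ} {ε : ℤ}
    (hε : ε = 1 ∨ ε = -1) {p : F[X]} (hm : p.Monic)
    (hp : Irreducible p) (hs : recip p = p) {x : K} (hx : aeval x p = 0)
    (hx0 : x ≠ 0) (hx1 : x ≠ x⁻¹) (hpow : x ^ n = (ε : K)) :
    HasStandardRep n ε p x (IntermediateField.adjoin F {x + x⁻¹}) .matSelf
      (2 * p.natDegree) := by
  have hint : IsIntegral F x := ⟨p, hm, hx⟩
  have hint' : IsIntegral F (x + x⁻¹) := hint.add hint.inv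
  have := IntermediateField.adjoin.finiteDimensional hint'
  have hcm := IntermediateField.mem_adjoin_simple_self F (x + x⁻¹)
  have hdeg := finrank_adjoin_add_inv_le hm hp hs hx hx0 hx1
  set L := IntermediateField.adjoin F {x + x⁻¹} with hL
  have hfin : Module.Finite F (Matrix (Fin 2) (Fin 2) L) := inferInstance
  have : Finite L := Module.finite_of_finite F
  refine ⟨hfin, ?_, ?_⟩
  · change Module.finrank F (Matrix (Fin 2) (Fin 2) L) ≤ _
    rw [Module.finrank_matrix, Fintype.card_fin]
    omega
  · let c : L := ⟨x + x⁻¹, hcm⟩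
    have hcv : (c : K) = x + x⁻¹ := rfl
    have h2L : (2 : L) ≠ 0 := by
      have := (map_ne_zero (algebraMap F L)).2 h2
      rwa [map_ofNat] at this
    have hxne : x - x⁻¹ ≠ 0 := sub_ne_zero.2 hx1
    have hc : c ^ 2 ≠ 4 := by
      intro h
      have h' : (x + x⁻¹) ^ 2 = 4 := by
        have := congrArg L.val h
        rw [map_pow, map_ofNat] at this
        exact this
      apply hxne
      have : (x - x⁻¹) ^ 2 = 0 := by
        have e := mul_inv_cancel₀ hx0
        linear_combination h' - 4 * e
      exact pow_eq_zero_iff (two_ne_zero) |>.1 this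
    obtain ⟨a, b, hab⟩ := exists_sq_add_mul_add_sq h2L hc (ε : L)
    have habK : (a : K) ^ 2 + (x + x⁻¹) * a * b + (b : K) ^ 2 = ε := by
      have := congrArg (algebraMap L K) hab
      simpa [c] using this
    let ξ : Matrix (Fin 2) (Fin 2) L := !![0, -1; 1, c]
    -- The trace-zero matrix with determinant `-(a² + cab + b²) = -ε`, hence with square `ε`.
    let η : Matrix (Fin 2) (Fin 2) L := !![b, a + c * b; a, -b]
    -- The rows are left eigenvectors of `ξ` for `x` and `x⁻¹`.
    let W : Matrix (Fin 2) (Fin 2) K := !![1, x; 1, x⁻¹]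
    have hW : IsUnit W := by
      rw [Matrix.isUnit_iff_isUnit_det, Matrix.det_fin_two_of, isUnit_iff_ne_zero]
      intro h
      exact hxne (by linear_combination -h)
    have hξ : W * L.val.mapMatrix ξ = !![x, 0; 0, x⁻¹] * W := by
      ext i j
      fin_cases i <;> fin_cases j <;>
        simp [W, ξ, hcv, Matrix.mul_apply, Fin.sum_univ_two] <;> field_simp <;> ring
    have hη : W * L.val.mapMatrix η = !![0, b + x * a; b + x⁻¹ * a, 0] * W := by
      ext i j
      fin_cases i <;> fin_cases j <;>
        simp [W, η, hcv, Matrix.mul_apply, Fin.sum_univ_two] <;> field_simp <;> ring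
    have hrep : IsBlockRep n ε p ξ η := by
      refine isBlockRep_of_conj_diag hp (hs.symm ▸ hp) hx hx0 hpow hε hW hξ hη ?_
      have e := mul_inv_cancel₀ hx0
      linear_combination habK + (a : K) ^ 2 * e
    have hroot : aeval ξ p = 0 :=
      aeval_eq_zero_of_conj_diag hW hξ hx (by have := aeval_inv_recip hx0 hx; rwa [hs] at this)
    exact ⟨ξ, η, hroot, hrep⟩

theorem aeval_algebraMap_self {A : Type v} [Ring A] [Algebra F A] (a : F) (P : F[X]) :
    aeval (algebraMap F A a) P = algebraMap F A (P.eval a) := by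
  rw [aeval_def, eval₂_at_apply]

theorem aeval_algebraMap_X_sub_C (A : Type v) [Ring A] [Algebra F A] (a : F) :
    aeval (algebraMap F A a) (X - C a) = 0 := by
  rw [aeval_algebraMap_self, eval_sub, eval_X, eval_C, sub_self, map_zero]

theorem hasStandardRep_split (h2 : (2 : F) ≠ 0) {n : ℕ} {ε : ℤ}
    (hε : ε = 1 ∨ ε = -1) {a : F} (ha2 : a * a = 1) (ha : a ^ n = (ε : F))
    (hs : recip (X - C a) = X - C a) (x : K) {i : F} (hi : i ^ 2 = ε) (hi1 : ε = 1 → i = 1) :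
    HasStandardRep n ε (X - C a) x (⊥ : IntermediateField F K) .split 2 := by
  set L := (⊥ : IntermediateField F K)
  have hrank : Module.finrank F L = 1 := IntermediateField.finrank_bot
  have hfL : Module.Finite F L := Module.finite_of_finrank_eq_succ hrank
  have hfin : Module.Finite F (L × L) := inferInstance
  refine ⟨hfin, ?_, ?_⟩
  · change Module.finrank F (L × L) ≤ _
    rw [Module.finrank_prod, hrank]
  · have hi0 : i ≠ 0 := by
      rintro rfl
      rcases hε with rfl | rfl <;> simp at hi
    let ξ : L × L := algebraMap F (L × L) a
    let j : L := algebraMap F L i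
    have hj : j ^ 2 = (ε : L) := by
      rw [← map_pow, hi, map_intCast]
    let η : L × L := (j, -j)
    have hrep : IsBlockRep n ε (X - C a) ξ η := by
      refine ⟨?_, ?_, ?_, ?_⟩
      · rw [← map_pow, ha, map_intCast]
      · ext <;> simp [η, hj]
      · rw [← Algebra.commutes, ← mul_assoc, ← map_mul, ha2, map_one, one_mul]
      · intro P Q h
        rw [hs]
        simp only [dvd_iff_isRoot, IsRoot.def, and_self]
        rw [aeval_algebraMap_self, aeval_algebraMap_self] at h
        have e1 : algebraMap F L (P.eval a + Q.eval a * i) = 0 := by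
          rw [map_add, map_mul]; exact congrArg Prod.fst h
        have e2 : algebraMap F L (P.eval a - Q.eval a * i) = 0 := by
          rw [map_sub, map_mul, sub_eq_add_neg, ← mul_neg]; exact congrArg Prod.snd h
        rw [map_eq_zero] at e1 e2
        have e3 : 2 * P.eval a = 0 := by linear_combination e1 + e2
        have e4 : P.eval a = 0 := (mul_eq_zero.1 e3).resolve_left h2
        refine ⟨e4, ?_⟩
        rw [e4, zero_add] at e1
        exact (mul_eq_zero.1 e1).resolve_right hi0
    refine ⟨ξ, η, ⟨?_, j, hj, ?_, rfl⟩, hrep⟩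
    · exact aeval_algebraMap_X_sub_C (L × L) a
    · intro h
      simp [j, hi1 h]

theorem hasStandardRep_quad {n : ℕ} {a : F} (ha2 : a * a = 1)
    (ha : a ^ n = ((-1 : ℤ) : F)) (hs : recip (X - C a) = X - C a) (x : K) :
    HasStandardRep n (-1) (X - C a) x (⊥ : IntermediateField F K) .quad 2 := by
  set L := (⊥ : IntermediateField F K)
  have hrank : Module.finrank F L = 1 := IntermediateField.finrank_bot
  have hfL : Module.Finite F L := Module.finite_of_finrank_eq_succ hrank
  have hdeg : (X ^ 2 + 1 : L[X]).natDegree = 2 := by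
    rw [← C_1]; exact natDegree_X_pow_add_C
  have hmon : (X ^ 2 + 1 : L[X]).Monic := by
    rw [← C_1]; exact monic_X_pow_add_C _ two_ne_zero
  have hfin' : Module.Finite L (AdjoinRoot (X ^ 2 + 1 : L[X])) := hmon.finite_adjoinRoot
  have hfree : Module.Free L (AdjoinRoot (X ^ 2 + 1 : L[X])) := hmon.free_adjoinRoot
  have hfin : Module.Finite F (AdjoinRoot (X ^ 2 + 1 : L[X])) := Module.Finite.trans L _
  refine ⟨hfin, ?_, ?_⟩
  · change Module.finrank F (AdjoinRoot (X ^ 2 + 1 : L[X])) ≤ _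
    rw [← Module.finrank_mul_finrank F L, hrank, one_mul,
      (AdjoinRoot.powerBasis' hmon).finrank, AdjoinRoot.powerBasis'_dim, hdeg]
  · let ξ : AdjoinRoot (X ^ 2 + 1 : L[X]) := algebraMap F _ a
    let η : AdjoinRoot (X ^ 2 + 1 : L[X]) := AdjoinRoot.root _
    have hη : η ^ 2 = -1 := by
      have := AdjoinRoot.mk_self (f := (X ^ 2 + 1 : L[X]))
      rw [map_add, map_pow, AdjoinRoot.mk_X, map_one] at this
      exact eq_neg_of_add_eq_zero_left this
    have hrep : IsBlockRep n (-1) (X - C a) ξ η := by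
      refine ⟨?_, ?_, ?_, ?_⟩
      · rw [← map_pow, ha, map_intCast]
      · rw [hη]; simp
      · rw [← Algebra.commutes, ← mul_assoc, ← map_mul, ha2, map_one, one_mul]
      · intro P Q h
        rw [hs]
        simp only [dvd_iff_isRoot, IsRoot.def, and_self]
        rw [aeval_algebraMap_self, aeval_algebraMap_self] at h
        -- The relation says that `X² + 1` divides the polynomial `Q(a) X + P(a)` of degree at most
        -- 1, which must then vanish. Irreducibility of `X² + 1` plays no role.
        have h' : AdjoinRoot.mk (X ^ 2 + 1 : L[X])
            (C (algebraMap F L (Q.eval a)) * X + C (algebraMap F L (P.eval a))) = 0 := by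
          rw [map_add, map_mul, AdjoinRoot.mk_C, AdjoinRoot.mk_C, AdjoinRoot.mk_X]
          exact (add_comm _ _).trans h
        rw [AdjoinRoot.mk_eq_zero] at h'
        have h0 := eq_zero_of_dvd_of_natDegree_lt h' (by
          rw [hdeg]; exact lt_of_le_of_lt natDegree_linear_le one_lt_two)
        have c0 := congrArg (coeff · 0) h0
        have c1 := congrArg (coeff · 1) h0
        simp [coeff_C] at c0 c1
        exact ⟨c0, c1⟩
    refine ⟨ξ, η, ⟨?_, rfl⟩, hrep⟩
    exact aeval_algebraMap_X_sub_C (AdjoinRoot (X ^ 2 + 1 : L[X])) a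

end StandardRep

/-! ### Universal property and normal form of the group algebra -/

section GroupAlgebra

/-- The map is `a i ↦ a^i`, `xa i ↦ b a^i`, where `E i` is the power `a^i` with exponent in `ZMod
(2n)`. The four multiplication rules follow from `E i * b = b * E (-i)` and `b² = E n`. -/
theorem QuaternionGroup.exists_lift {G : Type u} [Group G] {n : ℕ} {a b : G}
    (ha : a ^ (2 * n) = 1) (hb : b ^ 2 = a ^ n) (hab : a * b * a = b) :
    ∃ φ : QuaternionGroup n →* G, φ (.a 1) = a ∧ φ (.xa 0) = b := by
  let e : ZMod (2 * n) →+ Additive G := ZMod.lift (2 * n) ⟨zmultiplesHom (Additive G) (.ofMul a), by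
    rw [zmultiplesHom_apply, natCast_zsmul, ← ofMul_pow, ha, ofMul_one]⟩
  let E : ZMod (2 * n) → G := fun i => (e i).toMul
  have hE : ∀ i j, E (i + j) = E i * E j := fun i j => congrArg Additive.toMul (map_add e i j)
  have hE0 : E 0 = 1 := congrArg Additive.toMul (map_zero e)
  have hEcast : ∀ z : ℤ, E z = a ^ z := fun z => by
    exact congrArg Additive.toMul (ZMod.lift_coe (2 * n) _ z)
  have hE1 : E 1 = a := by simpa using hEcast 1
  have hEn : E (n : ZMod (2 * n)) = b * b := by
    rw [← pow_two, hb]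
    simpa using hEcast n
  have hEneg : ∀ i, E (-i) = (E i)⁻¹ := fun i => congrArg Additive.toMul (map_neg e i)
  have hsemi : SemiconjBy b a a⁻¹ := by
    rw [SemiconjBy, eq_inv_mul_iff_mul_eq, ← mul_assoc, hab]
  have hcomm : ∀ i, b * E i = (E i)⁻¹ * b := fun i => by
    obtain ⟨z, rfl⟩ := ZMod.intCast_surjective i
    rw [hEcast, ← inv_zpow]
    exact hsemi.zpow_right z
  have hEb : ∀ i, E i * b = b * E (-i) := fun i => by rw [hcomm, hEneg, inv_inv]
  let φ : QuaternionGroup n → G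
    | .a i => E i
    | .xa i => b * E i
  refine ⟨MonoidHom.mk' φ ?_, hE1, ?_⟩
  · rintro (i | i) (j | j)
    · exact hE i j
    · change b * E (j - i) = E i * (b * E j)
      rw [← mul_assoc, hEb, mul_assoc, ← hE, neg_add_eq_sub]
    · change b * E (i + j) = b * E i * E j
      rw [hE, mul_assoc]
    · change E (n + j - i) = b * E i * (b * E j)
      rw [mul_assoc, ← mul_assoc (E i), hEb, mul_assoc, ← mul_assoc, ← hEn, ← hE, ← hE]
      congr 1
      abel
  · change b * E 0 = b
    rw [hE0, mul_one]

variable {F : Type u} [Field F]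

theorem QAlg.exists_lift {A : Type v} [Ring A] [Algebra F A] {n : ℕ} (hn : n ≠ 0) {ε : ℤ}
    (hε : ε = 1 ∨ ε = -1) {p : F[X]} {ξ η : A} (h : IsBlockRep n ε p ξ η) :
    ∃ φ : QAlg F n →ₐ[F] A, φ (qx F n) = ξ ∧ φ (qy F n) = η := by
  have hεε : (ε : A) * ε = 1 := by rcases hε with rfl | rfl <;> simp
  have hξ : ξ ^ (2 * n) = 1 := by rw [two_mul, pow_add, h.pow, hεε]
  have hη : η ^ 4 = 1 := by
    rw [show 4 = 2 + 2 from rfl, pow_add, h.sq, hεε]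
  let a : Aˣ := Units.ofPowEqOne ξ (2 * n) hξ (by omega)
  let b : Aˣ := Units.ofPowEqOne η 4 hη (by omega)
  have ha : (a : A) = ξ := rfl
  have hb : (b : A) = η := rfl
  obtain ⟨φ, h1, h2⟩ := QuaternionGroup.exists_lift (n := n) (a := a) (b := b)
    (by ext; simpa [ha] using hξ) (by ext; simp [ha, hb, h.sq, h.pow])
    (by ext; simpa [ha, hb] using h.conj)
  refine ⟨MonoidAlgebra.lift F A _ ((Units.coeHom A).comp φ), ?_, ?_⟩
  · rw [qx, MonoidAlgebra.lift_of, MonoidHom.comp_apply, h1]; rfl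
  · rw [qy, MonoidAlgebra.lift_of, MonoidHom.comp_apply, h2]; rfl

theorem QAlg.exists_eq_aeval_add {n : ℕ} (hn : n ≠ 0) (z : QAlg F n) :
    ∃ P Q : F[X], z = aeval (qx F n) P + aeval (qx F n) Q * qy F n := by
  have : NeZero (2 * n) := ⟨by omega⟩
  have hpow : ∀ i : ZMod (2 * n),
      qx F n ^ i.val = MonoidAlgebra.of F (QuaternionGroup n) (.a i) := fun i => by
    rw [qx, ← map_pow, QuaternionGroup.a_one_pow, ZMod.natCast_zmod_val]
  induction z using MonoidAlgebra.induction_on with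
  | of g =>
    rcases g with i | i
    · exact ⟨X ^ i.val, 0, by simp [hpow]⟩
    -- In the normal form `y` stands on the right, whereas `xa i` is `y x^i = x^{-i} y`.
    · refine ⟨0, X ^ (-i).val, ?_⟩
      rw [map_zero, zero_add, map_pow, aeval_X, hpow, qy, ← map_mul, QuaternionGroup.a_mul_xa]
      simp
  | add x y hx hy =>
    obtain ⟨P, Q, rfl⟩ := hx
    obtain ⟨P', Q', rfl⟩ := hy
    refine ⟨P + P', Q + Q', ?_⟩
    rw [map_add, map_add, add_mul]
    abel
  | smul c x hx =>
    obtain ⟨P, Q, rfl⟩ := hx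
    exact ⟨c • P, c • Q, by rw [map_smul, map_smul, smul_add, smul_mul_assoc]⟩

theorem QAlg.finrank {n : ℕ} (hn : n ≠ 0) : Module.finrank F (QAlg F n) = 4 * n := by
  have : NeZero n := ⟨hn⟩
  rw [(MonoidAlgebra.coeffLinearEquiv F).finrank_eq, Module.finrank_finsupp_self,
    QuaternionGroup.card]

end GroupAlgebra

/-! ### Consequences of the factorization of `x^n - ε` -/

section Factorization
variable {F : Type u} [Field F]

/-- The monic irreducible factors of `X ^ n - ε` with the pairs of distinct reciprocal factors
represented by one member, after the self-reciprocal ones. -/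
structure IsReciprocalFactorization (n : ℕ) (ε : ℤ) (r : ℕ) {m : ℕ} (p : Fin m → F[X]) : Prop where
  monic : ∀ j, (p j).Monic
  irreducible : ∀ j, Irreducible (p j)
  recip_irreducible : ∀ j, Irreducible (recip (p j))
  self : ∀ j, j.val < r → recip (p j) = p j
  prod : (X ^ n - (ε : F[X])) = ∏ j, if j.val < r then p j else p j * recip (p j)

namespace IsReciprocalFactorization
variable {n : ℕ} {ε : ℤ} {r m : ℕ} {p : Fin m → F[X]}

theorem factor_dvd (h : IsReciprocalFactorization n ε r p) (j : Fin m) :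
    (if j.val < r then p j else p j * recip (p j)) ∣ (X ^ n - (ε : F[X])) := by
  rw [h.prod]
  exact Finset.dvd_prod_of_mem _ (Finset.mem_univ j)

theorem dvd (h : IsReciprocalFactorization n ε r p) (j : Fin m) :
    p j ∣ (X ^ n - (ε : F[X])) := by
  refine dvd_trans ?_ (h.factor_dvd j)
  split_ifs
  · exact dvd_rfl
  · exact dvd_mul_right _ _

theorem coeff_zero_ne (h : IsReciprocalFactorization n ε r p) (hn : n ≠ 0)
    (hε : ε = 1 ∨ ε = -1) (j : Fin m) : (p j).coeff 0 ≠ 0 := by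
  intro h0
  have h1 := (X_dvd_iff.2 h0).trans (h.dvd j)
  rw [X_dvd_iff] at h1
  rcases hε with rfl | rfl <;> simp [coeff_X_pow, hn.symm] at h1

theorem separable (hn : (n : F) ≠ 0) (hε : ε = 1 ∨ ε = -1) :
    (X ^ n - (ε : F[X])).Separable := by
  have := separable_X_pow_sub_C (ε : F) hn (by rcases hε with rfl | rfl <;> simp)
  simpa using this

/-- The product of two different factors divides `X^n - ε`, which is separable because `n` is
invertible in `F`. -/
theorem isCoprime (h : IsReciprocalFactorization n ε r p) (hn : (n : F) ≠ 0)
    (hε : ε = 1 ∨ ε = -1) {i j : Fin m} (hij : i ≠ j) :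
    IsCoprime (if i.val < r then p i else p i * recip (p i))
      (if j.val < r then p j else p j * recip (p j)) := by
  refine (Separable.of_dvd (separable hn hε) ?_).isCoprime
  rw [h.prod, ← Finset.prod_pair (f := fun j : Fin m => if j.val < r then p j else
    p j * recip (p j)) hij]
  exact Finset.prod_dvd_prod_of_subset _ _ _ (Finset.subset_univ _)

theorem ne (h : IsReciprocalFactorization n ε r p) (hn : (n : F) ≠ 0)
    (hε : ε = 1 ∨ ε = -1) {i j : Fin m} (hij : i ≠ j) : p i ≠ p j := by
  intro he
  have hc := h.isCoprime hn hε hij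
  refine (h.irreducible i).not_isUnit (hc.isUnit_of_dvd' ?_ ?_)
  · split_ifs
    · exact dvd_rfl
    · exact dvd_mul_right _ _
  · rw [he]
    split_ifs
    · exact dvd_rfl
    · exact dvd_mul_right _ _

/-- The factors are pairwise coprime, and within a pair `p` and `p*` are coprime by the same
separability. -/
theorem dvd_of_forall (h : IsReciprocalFactorization n ε r p) (hn : (n : F) ≠ 0)
    (hε : ε = 1 ∨ ε = -1) {P : F[X]} (hP : ∀ j, p j ∣ P ∧ recip (p j) ∣ P) :
    (X ^ n - (ε : F[X])) ∣ P := by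
  rw [h.prod]
  refine Finset.prod_dvd_of_coprime (fun i _ j _ hij => h.isCoprime hn hε hij) fun j _ => ?_
  have hs := Separable.of_dvd (separable hn hε) (h.factor_dvd j)
  split_ifs with hj
  · exact (hP j).1
  · rw [if_neg hj] at hs
    exact hs.isCoprime.mul_dvd (hP j).1 (hP j).2

theorem sum_natDegree (h : IsReciprocalFactorization n ε r p) :
    ∑ j, (if j.val < r then p j else p j * recip (p j)).natDegree = n := by
  rw [← natDegree_prod, ← h.prod]
  · have := natDegree_X_pow_sub_C (n := n) (r := (ε : F))
    simpa using this
  · intro j _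
    split_ifs
    · exact (h.irreducible j).ne_zero
    · exact mul_ne_zero (h.irreducible j).ne_zero (h.recip_irreducible j).ne_zero

variable {K : Type v} [Field K] [Algebra F K]

theorem root_pow (h : IsReciprocalFactorization n ε r p) {j : Fin m} {x : K}
    (hx : aeval x (p j) = 0) : x ^ n = (ε : K) := by
  have := ((h.irreducible j).dvd_iff_aeval hx _).1 (h.dvd j)
  simpa [sub_eq_zero] using this

theorem root_ne_zero (h : IsReciprocalFactorization n ε r p) (hn : n ≠ 0)
    (hε : ε = 1 ∨ ε = -1) {j : Fin m} {x : K} (hx : aeval x (p j) = 0) : x ≠ 0 := by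
  rintro rfl
  have := h.root_pow hx
  rw [zero_pow hn] at this
  rcases hε with rfl | rfl <;> simp at this

theorem hasStandardRep_of_le (h : IsReciprocalFactorization n ε r p) (hn : n ≠ 0)
    (hε : ε = 1 ∨ ε = -1) {d : ℕ} (hd : d ≤ r) {j : Fin m} {x : K} (hx : aeval x (p j) = 0)
    (hj : r ≤ j.val) :
    HasStandardRep n ε (p j) x (blockField F d r j x) .matPair
      (2 * (if j.val < r then p j else p j * recip (p j)).natDegree) := by
  rw [blockField, if_neg (by omega), if_neg (by omega), if_neg (by omega),
    natDegree_mul (h.irreducible j).ne_zero (h.recip_irreducible j).ne_zero,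
    natDegree_recip (h.coeff_zero_ne hn hε j), ← two_mul, ← mul_assoc]
  exact hasStandardRep_matPair hε (h.monic j) (h.irreducible j) (h.recip_irreducible j) hx
    (h.root_ne_zero hn hε hx) (h.root_pow hx)

/-- A root with `x = x⁻¹` is `±1`, which would make the factor `X - 1` or `X + 1`; so excluding
these two gives `x ≠ x⁻¹`. -/
theorem hasStandardRep_of_lt [Finite F] (h2 : (2 : F) ≠ 0)
    (h : IsReciprocalFactorization n ε r p) (hn : n ≠ 0)
    (hε : ε = 1 ∨ ε = -1) {d : ℕ} {j : Fin m} {x : K} (hx : aeval x (p j) = 0)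
    (hdj : d ≤ j.val) (hj : j.val < r) (h1 : p j ≠ X - 1) (h1' : p j ≠ X + 1) :
    HasStandardRep n ε (p j) x (blockField F d r j x) .matSelf
      (2 * (if j.val < r then p j else p j * recip (p j)).natDegree) := by
  rw [blockField, if_neg (by omega), if_pos hj, if_pos hj]
  have h0 := h.root_ne_zero hn hε hx
  have hm : ∀ a : F, x = algebraMap F K a → p j = X - C a := fun a ha =>
    (eq_of_monic_of_associated (monic_X_sub_C a) (h.monic j)
      ((irreducible_X_sub_C a).associated_of_dvd (h.irreducible j)
        (((irreducible_X_sub_C a).dvd_iff_aeval (x := x) (by simp [ha]) _).2 hx))).symm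
  refine hasStandardRep_matSelf h2 hε (h.monic j) (h.irreducible j) (h.self j hj) hx h0 ?_
    (h.root_pow hx)
  intro he
  have hsq : x * x = 1 := by nth_rewrite 2 [he]; exact mul_inv_cancel₀ h0
  rcases mul_self_eq_one_iff.1 hsq with e | e
  · exact h1 (by simpa using hm 1 (by simp [e]))
  · exact h1' (by simpa using hm (-1) (by simp [e]))

end IsReciprocalFactorization
end Factorization

/-! ### Existence of a standard isomorphism -/

section Existence
variable {F : Type u} [Field F] {K : Type v} [Field K] [Algebra F K]

theorem two_mul_natDegree_ite {j r : ℕ} (hj : j < r) {p q : F[X]} {a : F} (ha : p = X - C a) :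
    2 * (if j < r then p else q).natDegree = 2 := by
  rw [if_pos hj, ha, natDegree_X_sub_C]

/-- Injectivity comes from the divisibility property of the blocks, surjectivity from the dimension
bound `2n + 2n = 4n`. -/
theorem exists_algEquiv_of_hasStandardRep {n : ℕ} (hn : n ≠ 0) (hnF : (n : F) ≠ 0)
    (h2 : (2 : F) ≠ 0) {r t m m' : ℕ}
    {f : Fin m → F[X]} {g : Fin m' → F[X]} (hf : IsReciprocalFactorization n 1 r f)
    (hg : IsReciprocalFactorization n (-1) t g) {x : Fin m → K} {y : Fin m' → K}
    {L : Fin m → IntermediateField F K} {L' : Fin m' → IntermediateField F K}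
    {κ : Fin m → BlockKind} {κ' : Fin m' → BlockKind}
    (hL : ∀ j, HasStandardRep n 1 (f j) (x j) (L j) (κ j)
      (2 * (if j.val < r then f j else f j * recip (f j)).natDegree))
    (hL' : ∀ i, HasStandardRep n (-1) (g i) (y i) (L' i) (κ' i)
      (2 * (if i.val < t then g i else g i * recip (g i)).natDegree)) :
    ∃ ρ : QAlg F n ≃ₐ[F] ((j : Fin m) → Block (L j) (κ j)) × ((i : Fin m') → Block (L' i) (κ' i)),
      (∀ j, IsStandardImage (L j) 1 (f j) (x j) (κ j) ((ρ (qx F n)).1 j) ((ρ (qy F n)).1 j)) ∧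
      ∀ i, IsStandardImage (L' i) (-1) (g i) (y i) (κ' i)
        ((ρ (qx F n)).2 i) ((ρ (qy F n)).2 i) := by
  choose hfin hrank ξ η hstd hrep using hL
  choose hfin' hrank' ξ' η' hstd' hrep' using hL'
  choose φ hφx hφy using fun j => QAlg.exists_lift hn (Or.inl rfl) (hrep j)
  choose ψ hψx hψy using fun i => QAlg.exists_lift hn (Or.inr rfl) (hrep' i)
  let Φ := (AlgHom.pi φ).prod (AlgHom.pi ψ)
  have hinj : Function.Injective Φ := by
    rw [injective_iff_map_eq_zero]
    intro z hz
    obtain ⟨P, Q, rfl⟩ := QAlg.exists_eq_aeval_add hn z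
    have h1 : ∀ j, (f j ∣ P ∧ recip (f j) ∣ P) ∧ (f j ∣ Q ∧ recip (f j) ∣ Q) := fun j => by
      apply (hrep j).dvd
      have := congrFun (congrArg Prod.fst hz) j
      change φ j _ = 0 at this
      rwa [map_add, map_mul, ← aeval_algHom_apply, ← aeval_algHom_apply, hφx, hφy] at this
    have h1' : ∀ i, (g i ∣ P ∧ recip (g i) ∣ P) ∧ (g i ∣ Q ∧ recip (g i) ∣ Q) := fun i => by
      apply (hrep' i).dvd
      have := congrFun (congrArg Prod.snd hz) i
      change ψ i _ = 0 at this
      rwa [map_add, map_mul, ← aeval_algHom_apply, ← aeval_algHom_apply, hψx, hψy] at this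
    -- Half the difference of `X^n + 1` and `X^n - 1` is 1.
    have hcop : IsCoprime (X ^ n - ((1 : ℤ) : F[X])) (X ^ n - ((-1 : ℤ) : F[X])) :=
      ⟨C (-2⁻¹), C 2⁻¹, by
        have : (C (2⁻¹ : F)) * 2 = 1 := by
          rw [← C_ofNat, ← C_mul, inv_mul_cancel₀ h2, C_1]
        push_cast
        rw [C_neg]
        linear_combination this⟩
    have hzero : ∀ R : F[X], (X ^ n - ((1 : ℤ) : F[X])) ∣ R → (X ^ n - ((-1 : ℤ) : F[X])) ∣ R →
        aeval (qx F n) R = 0 := by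
      intro R hR hR'
      obtain ⟨S, rfl⟩ := hcop.mul_dvd hR hR'
      have : (X ^ n - ((1 : ℤ) : F[X])) * (X ^ n - ((-1 : ℤ) : F[X])) = X ^ (2 * n) - 1 := by
        push_cast
        ring
      rw [this, map_mul, map_sub, map_pow, aeval_X, qx_pow_two_mul, map_one, sub_self, zero_mul]
    rw [hzero P (hf.dvd_of_forall hnF (Or.inl rfl) fun j => (h1 j).1)
        (hg.dvd_of_forall hnF (Or.inr rfl) fun i => (h1' i).1),
      hzero Q (hf.dvd_of_forall hnF (Or.inl rfl) fun j => (h1 j).2)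
        (hg.dvd_of_forall hnF (Or.inr rfl) fun i => (h1' i).2), zero_mul, zero_add]
  have hle := LinearMap.finrank_le_finrank_of_injective (f := Φ.toLinearMap) hinj
  have hge : Module.finrank F (((j : Fin m) → Block (L j) (κ j)) ×
      ((i : Fin m') → Block (L' i) (κ' i))) ≤ Module.finrank F (QAlg F n) := by
    rw [Module.finrank_prod, Module.finrank_pi_fintype, Module.finrank_pi_fintype,
      QAlg.finrank hn]
    calc _ ≤ ∑ j, 2 * (if j.val < r then f j else f j * recip (f j)).natDegree +
          ∑ i, 2 * (if i.val < t then g i else g i * recip (g i)).natDegree :=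
        add_le_add (Finset.sum_le_sum fun j _ => hrank j) (Finset.sum_le_sum fun i _ => hrank' i)
      _ = 4 * n := by
        rw [← Finset.mul_sum, ← Finset.mul_sum, hf.sum_natDegree, hg.sum_natDegree]
        ring
  have : Module.Finite F (QAlg F n) := Module.finite_of_finrank_pos (by rw [QAlg.finrank hn]; omega)
  have hsurj : Function.Surjective Φ :=
    (LinearMap.injective_iff_surjective_of_finrank_eq_finrank (f := Φ.toLinearMap)
      (le_antisymm hle hge)).1 hinj
  refine ⟨AlgEquiv.ofBijective Φ ⟨hinj, hsurj⟩, fun j => ?_, fun i => ?_⟩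
  · change IsStandardImage _ _ _ _ _ (φ j (qx F n)) (φ j (qy F n))
    rw [hφx, hφy]
    exact hstd j
  · change IsStandardImage _ _ _ _ _ (ψ i (qx F n)) (ψ i (qy F n))
    rw [hψx, hψy]
    exact hstd' i

namespace IsQFactorization
variable {n r s t k : ℕ} {f : Fin (r + s) → F[X]} {g : Fin (t + k) → F[X]}

theorem left (h : IsQFactorization n r s t k f g) : IsReciprocalFactorization n 1 r f :=
  ⟨h.f_monic, h.f_irreducible, h.f_recip_irreducible, h.f_self, by simpa using h.f_prod⟩

theorem right (h : IsQFactorization n r s t k f g) : IsReciprocalFactorization n (-1) t g :=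
  ⟨h.g_monic, h.g_irreducible, h.g_recip_irreducible, h.g_self, by simpa using h.g_prod⟩

/-- The linear factors `X ± 1` that occur are the first `δ(n)` ones. No later factor equals `X ± 1`:
factors are distinct, and for odd `n` the element `-1` is not a root of `X^n - 1`. -/
theorem hasStandardRep_left [Finite F] (h : IsQFactorization n r s t k f g) (hn : n ≠ 0)
    (hnF : (n : F) ≠ 0) (h2 : (2 : F) ≠ 0) {x : K} (j : Fin (r + s)) (hx : aeval x (f j) = 0) :
    HasStandardRep n 1 (f j) x (blockField F (delta n) r j x) (kindA n r j)
      (2 * (if j.val < r then f j else f j * recip (f j)).natDegree) := by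
  have hdr := h.delta_le
  rcases lt_or_ge j.val (delta n) with hj | hj
  · have hjr : j.val < r := lt_of_lt_of_le hj hdr
    have key : ∀ a : F, f j = X - C a → a * a = 1 → a ^ n = ((1 : ℤ) : F) →
        HasStandardRep n 1 (f j) x (blockField F (delta n) r j x) (kindA n r j)
          (2 * (if j.val < r then f j else f j * recip (f j)).natDegree) := by
      intro a ha ha2 han
      rw [two_mul_natDegree_ite hjr ha, kindA, if_pos hj, blockField, if_pos hj, ha]
      exact hasStandardRep_split h2 (Or.inl rfl) ha2 han (by rw [← ha]; exact h.f_self j hjr) x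
        (i := 1) (by simp) fun _ => rfl
    by_cases hj0 : j.val = 0
    · exact key 1 (by rw [h.f_first j hj0, C_1]) (by simp) (by simp)
    · have he : Even n := by
        by_contra he
        rw [delta, if_neg he] at hj
        omega
      rw [delta, if_pos he] at hj
      exact key (-1) (by rw [h.f_second he j (by omega)]; simp) (by simp) (by simp [he.neg_pow])
  · have h0 : 0 < delta n := by
      unfold delta
      split_ifs <;> omega
    rcases lt_or_ge j.val r with hjr | hjr
    · rw [kindA, if_neg (by omega), if_pos hjr]
      refine h.left.hasStandardRep_of_lt h2 hn (Or.inl rfl) hx hj hjr ?_ ?_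
      · let j0 : Fin (r + s) := ⟨0, by omega⟩
        rw [← h.f_first j0 rfl]
        refine h.left.ne hnF (Or.inl rfl) fun e => ?_
        have : j.val = 0 := congrArg Fin.val e
        omega
      · by_cases he : Even n
        · have hd2 : delta n = 2 := if_pos he
          let j1 : Fin (r + s) := ⟨1, by omega⟩
          rw [← h.f_second he j1 rfl]
          refine h.left.ne hnF (Or.inl rfl) fun e => ?_
          have : j.val = 1 := congrArg Fin.val e
          omega
        · intro e
          have hr : aeval (-1 : F) (f j) = 0 := by simp [e]
          have := h.left.root_pow hr
          rw [(Nat.not_even_iff_odd.1 he).neg_one_pow] at this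
          apply h2
          push_cast at this
          linear_combination -this
    · rw [kindA, if_neg (by omega), if_neg (by omega)]
      exact h.left.hasStandardRep_of_le hn (Or.inl rfl) hdr hx hjr

theorem hasStandardRep_right [Finite F] (h : IsQFactorization n r s t k f g) (hn : n ≠ 0)
    (hnF : (n : F) ≠ 0) (h2 : (2 : F) ≠ 0) {x : K} (j : Fin (t + k)) (hx : aeval x (g j) = 0) :
    HasStandardRep n (-1) (g j) x (blockField F (mu n) t j x) (kindB (Nat.card F) n t j)
      (2 * (if j.val < t then g j else g j * recip (g j)).natDegree) := by
  have hdr := h.mu_le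
  rcases lt_or_ge j.val (mu n) with hj | hj
  · have hjr : j.val < t := lt_of_lt_of_le hj hdr
    have ho : Odd n := by
      by_contra ho
      rw [mu, if_pos (Nat.not_odd_iff_even.1 ho)] at hj
      omega
    have hmu : mu n = 1 := if_neg (Nat.not_even_iff_odd.2 ho)
    have ha : g j = X - C (-1) := by rw [h.g_first ho j (by omega)]; simp
    have hs : recip (X - C (-1 : F)) = X - C (-1) := by rw [← ha]; exact h.g_self j hjr
    have hp : (-1 : F) ^ n = ((-1 : ℤ) : F) := by simp [ho.neg_one_pow]
    rw [two_mul_natDegree_ite hjr ha, kindB, if_pos hj, blockField, if_pos hj, ha]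
    split_ifs with hq
    · cases nonempty_fintype F
      -- In a finite field `-1` is a square unless `q ≡ 3 (mod 4)`.
      obtain ⟨i, hi⟩ : IsSquare (-1 : F) := by
        rw [FiniteField.isSquare_neg_one_iff, ← Nat.card_eq_fintype_card]
        omega
      exact hasStandardRep_split h2 (Or.inr rfl) (by simp) hp hs x (i := i)
        (by rw [pow_two, ← hi]; simp) (by intro e; omega)
    · exact hasStandardRep_quad (by simp) hp hs x
  · rcases lt_or_ge j.val t with hjr | hjr
    · rw [kindB, if_neg (by omega), if_pos hjr]
      refine h.right.hasStandardRep_of_lt h2 hn (Or.inr rfl) hx hj hjr ?_ ?_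
      · intro e
        have hr : aeval (1 : F) (g j) = 0 := by simp [e]
        have := h.right.root_pow hr
        apply h2
        push_cast at this
        rw [one_pow] at this
        linear_combination this
      · by_cases he : Even n
        · intro e
          have hr : aeval (-1 : F) (g j) = 0 := by simp [e]
          have := h.right.root_pow hr
          rw [he.neg_one_pow] at this
          apply h2
          push_cast at this
          linear_combination this
        · have hmu : mu n = 1 := if_neg he
          let j0 : Fin (t + k) := ⟨0, by omega⟩
          rw [← h.g_first (Nat.not_even_iff_odd.1 he) j0 rfl]
          refine h.right.ne hnF (Or.inr rfl) fun e => ?_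
          have : j.val = 0 := congrArg Fin.val e
          omega
    · rw [kindB, if_neg (by omega), if_neg (by omega)]
      exact h.right.hasStandardRep_of_le hn (Or.inr rfl) hdr hx hjr

end IsQFactorization
end Existence

/-! ### Left ideals generated by `H(ξ)` in the blocks -/

section Code
variable {F : Type u} [Field F] {K : Type v} [Field K] [Algebra F K]

theorem inducedCode_eq_span (n l : ℕ) (hl : l ∣ 2 * n) (h : F[X]) :
    inducedCode F n l hl h = Ideal.span {aeval (qx F n) (h.comp (X ^ l))} := by
  have hΩ : ∀ c : F[X], Omega F n l hl (Ideal.Quotient.mk _ c) =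
      aeval (qx F n) (c.comp (X ^ l)) := fun c => by
    rw [aeval_comp, map_pow, aeval_X]
    rfl
  apply le_antisymm
  · refine Ideal.span_le.2 ?_
    rintro _ ⟨z, hz, rfl⟩
    obtain ⟨c, rfl⟩ := Ideal.mem_span_singleton'.1 hz
    obtain ⟨c, rfl⟩ := Ideal.Quotient.mk_surjective c
    rw [map_mul, hΩ, hΩ]
    exact Ideal.mul_mem_left _ _ (Ideal.subset_span rfl)
  · refine Ideal.span_le.2 ?_
    rintro _ rfl
    exact Ideal.subset_span ⟨_, Ideal.subset_span rfl, hΩ h⟩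

section Matrices
variable {L : IntermediateField F K} {M : Matrix (Fin 2) (Fin 2) L}

theorem exists_mul_eq_of_diag (h01 : M 0 1 = 0) (h10 : M 1 0 = 0) (h0 : M 0 0 ≠ 0)
    (h1 : M 1 1 ≠ 0) (b : Matrix (Fin 2) (Fin 2) L) : ∃ c, c * M = b := by
  refine ⟨!![b 0 0 / M 0 0, b 0 1 / M 1 1; b 1 0 / M 0 0, b 1 1 / M 1 1], ?_⟩
  ext i j
  fin_cases i <;> fin_cases j <;> simp [Matrix.mul_apply, Fin.sum_univ_two, h01, h10, h0, h1]

theorem exists_mul_eq_iff_mem_matLine_zero_one (h01 : M 0 1 = 0) (h10 : M 1 0 = 0)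
    (h0 : M 0 0 ≠ 0) (h1 : M 1 1 = 0) (b : Matrix (Fin 2) (Fin 2) L) :
    (∃ c, c * M = b) ↔ b ∈ matLine L 0 1 := by
  constructor
  · rintro ⟨c, rfl⟩
    refine ⟨c 0 0 * M 0 0, c 1 0 * M 0 0, ?_⟩
    ext i j
    fin_cases i <;> fin_cases j <;> simp [Matrix.mul_apply, Fin.sum_univ_two, h01, h10, h1]
  · rintro ⟨a, b, rfl⟩
    refine ⟨!![a / M 0 0, 0; b / M 0 0, 0], ?_⟩
    ext i j
    fin_cases i <;> fin_cases j <;> simp [Matrix.mul_apply, Fin.sum_univ_two, h01, h0]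

theorem exists_mul_eq_iff_mem_matLine_one_zero (h01 : M 0 1 = 0) (h10 : M 1 0 = 0)
    (h0 : M 0 0 = 0) (h1 : M 1 1 ≠ 0) (b : Matrix (Fin 2) (Fin 2) L) :
    (∃ c, c * M = b) ↔ b ∈ matLine L 1 0 := by
  constructor
  · rintro ⟨c, rfl⟩
    -- The signs undo those of the second column in `matLine`.
    refine ⟨-(c 0 1 * M 1 1), -(c 1 1 * M 1 1), ?_⟩
    ext i j
    fin_cases i <;> fin_cases j <;> simp [Matrix.mul_apply, Fin.sum_univ_two, h01, h10, h0]
  · rintro ⟨a, b, rfl⟩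
    refine ⟨!![0, -(a / M 1 1); 0, -(b / M 1 1)], ?_⟩
    ext i j
    fin_cases i <;> fin_cases j <;> simp [Matrix.mul_apply, Fin.sum_univ_two, h10, h1]

theorem eq_zero_of_diag (h01 : M 0 1 = 0) (h10 : M 1 0 = 0) (h0 : M 0 0 = 0) (h1 : M 1 1 = 0) :
    M = 0 := by
  ext i j
  fin_cases i <;> fin_cases j <;> simp [h01, h10, h0, h1]

end Matrices

theorem exists_mul_eq_zero_iff {A : Type v} [Ring A] (b : A) : (∃ c : A, c * 0 = b) ↔ b = 0 := by
  simp [eq_comm]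

theorem IsStandardImage.aeval_eq_zero {L : IntermediateField F K} {ε : ℤ} {p : F[X]} {x : K}
    {κ : BlockKind} {ξ η : Block L κ} (h : IsStandardImage L ε p x κ ξ η) (hκ : κ ≠ .matPair) :
    aeval ξ p = 0 := by
  cases κ
  · exact h.1
  · exact h.1
  · exact h
  · exact absurd rfl hκ

/-- The proposition `D` stands for the condition that the index is at least `δ(n)` or `μ(n)`. It is
needed only for pairs: when `p = p*`, exactly one of the cases "both divide" and "neither divides"
holds. -/
theorem IsStandardImage.exists_mul_eq_iff {L : IntermediateField F K} {ε : ℤ} {p : F[X]} {x : K}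
    {κ : BlockKind} {ξ η : Block L κ} (h : IsStandardImage L ε p x κ ξ η) (hp : Irreducible p)
    (hp' : Irreducible (recip p)) (hx : aeval x p = 0) (hx0 : x ≠ 0)
    (hs : κ ≠ .matPair → recip p = p) {D : Prop} (hD : κ = .matPair → D) (H : F[X])
    (b : Block L κ)
    {_ : Decidable (¬ p ∣ H ∧ ¬ recip p ∣ H)} {_ : Decidable (D ∧ ¬ p ∣ H ∧ recip p ∣ H)}
    {_ : Decidable (D ∧ p ∣ H ∧ ¬ recip p ∣ H)} :
    (∃ c, c * aeval ξ H = b) ↔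
      b ∈ (if ¬ p ∣ H ∧ ¬ recip p ∣ H then ⊤
        else if D ∧ ¬ p ∣ H ∧ recip p ∣ H then lineIdeal L κ 0 1
        else if D ∧ p ∣ H ∧ ¬ recip p ∣ H then lineIdeal L κ 1 0
        else ⊥ : Submodule F (Block L κ)) := by
  by_cases hκ : κ = .matPair
  · subst hκ
    have hx' := aeval_inv_recip hx0 hx
    have e := hD rfl
    let ξ' : Matrix (Fin 2) (Fin 2) L := ξ
    have hM : L.val.mapMatrix (aeval ξ' H) = !![aeval x H, 0; 0, aeval x⁻¹ H] := by
      rw [← aeval_algHom_apply, ← aeval_diag]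
      congr 1
      exact congrArg aeval h.1
    have h01 : (aeval ξ' H) 0 1 = 0 := Subtype.ext (congrFun (congrFun hM 0) 1)
    have h10 : (aeval ξ' H) 1 0 = 0 := Subtype.ext (congrFun (congrFun hM 1) 0)
    have h00 : (aeval ξ' H) 0 0 = 0 ↔ p ∣ H := by
      rw [hp.dvd_iff_aeval hx, Subtype.ext_iff]
      exact Eq.congr_left (congrFun (congrFun hM 0) 0)
    have h11 : (aeval ξ' H) 1 1 = 0 ↔ recip p ∣ H := by
      rw [hp'.dvd_iff_aeval hx', Subtype.ext_iff]
      exact Eq.congr_left (congrFun (congrFun hM 1) 1)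
    by_cases d : p ∣ H <;> by_cases d' : recip p ∣ H
    · have hz : aeval ξ H = 0 := eq_zero_of_diag h01 h10 (h00.2 d) (h11.2 d')
      simp only [d, d', e, not_true, and_true, and_false, if_false,
        Submodule.mem_bot]
      rw [hz]
      exact exists_mul_eq_zero_iff b
    · simp only [d, d', e, not_true, not_false_iff, and_true, and_false, if_false, if_true]
      exact exists_mul_eq_iff_mem_matLine_one_zero h01 h10 (h00.2 d) (mt h11.1 d') b
    · simp only [d, d', e, not_true, not_false_iff, and_true, and_false, if_false, if_true]
      exact exists_mul_eq_iff_mem_matLine_zero_one h01 h10 (mt h00.1 d) (h11.2 d') b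
    · simp only [d, d', not_false_iff, and_true, if_true, Submodule.mem_top, iff_true]
      exact exists_mul_eq_of_diag h01 h10 (mt h00.1 d) (mt h11.1 d') b
  · have hroot := h.aeval_eq_zero hκ
    have hr : recip p ∣ H ↔ p ∣ H := by rw [hs hκ]
    by_cases d : p ∣ H
    · have hz : aeval ξ H = 0 := by
        obtain ⟨Q, rfl⟩ := d
        rw [map_mul, hroot, zero_mul]
      simp only [hr, d, not_true, and_true, and_false, if_false, Submodule.mem_bot, hz]
      exact exists_mul_eq_zero_iff b
    -- Bézout modulo `p`, evaluated at `ξ` where `p` vanishes, gives `Q(ξ)` as a left inverse of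
    -- `H(ξ)`.
    · obtain ⟨P, Q, hPQ⟩ := hp.coprime_iff_not_dvd.2 d
      have h1 := congrArg (aeval ξ) hPQ
      rw [map_add, map_mul, map_mul, hroot, mul_zero, zero_add, map_one] at h1
      simp only [hr, d, not_false_iff, and_true, if_true, Submodule.mem_top, iff_true]
      exact ⟨b * aeval ξ Q, by rw [mul_assoc, h1, mul_one]⟩

end Code

/-! ### The main theorem -/

theorem mainTheorem2 {F : Type u} {K : Type v} [Field F] [Finite F] [Field K] [Algebra F K]
    (n r s t k : ℕ) (hq : Nat.Coprime (4 * n) (Nat.card F))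
    (f : Fin (r + s) → F[X]) (g : Fin (t + k) → F[X])
    (hfg : IsQFactorization n r s t k f g)
    (α : Fin (r + s) → K) (hα : ∀ j, aeval (α j) (f j) = 0)
    (β : Fin (t + k) → K) (hβ : ∀ i, aeval (β i) (g i) = 0) :
    (∃ ρ, IsWedderburnMap n r s t k f g α β ρ) ∧
    ∀ ρ, IsWedderburnMap n r s t k f g α β ρ →
      ∀ (l : ℕ) (hl : l ∣ 2 * n) (h : F[X]),
        ((inducedCode F n l hl h).restrictScalars F).map ρ.toLinearMap =
          (Submodule.pi Set.univ (codeBlockA n r s f α l h)).prod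
            (Submodule.pi Set.univ (codeBlockB n t k g β l h)) := by
  -- As `q = 0` in `F`, coprimality makes `4n` nonzero there, so both 2 and `n` are invertible.
  have h4n : ((4 * n : ℕ) : F) ≠ 0 := by
    intro h0
    cases nonempty_fintype F
    have hcard : ((Nat.card F : ℕ) : F) = 0 := by
      rw [Nat.card_eq_fintype_card, FiniteField.cast_card_eq_zero]
    have hco := (Nat.isCoprime_iff_coprime.2 hq).map (Int.castRingHom F)
    simp only [eq_intCast, Int.cast_natCast, h0, hcard] at hco
    exact not_isCoprime_zero_zero hco
  push_cast at h4n
  have hnF : (n : F) ≠ 0 := right_ne_zero_of_mul h4n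
  have h2 : (2 : F) ≠ 0 := by
    intro h
    apply left_ne_zero_of_mul h4n
    linear_combination 2 * h
  have hn : n ≠ 0 := by
    rintro rfl
    simp at hnF
  refine ⟨?_, ?_⟩
  · obtain ⟨ρ, h1, h1'⟩ := exists_algEquiv_of_hasStandardRep hn hnF h2 hfg.left hfg.right
      (fun j => hfg.hasStandardRep_left hn hnF h2 j (hα j))
      (fun i => hfg.hasStandardRep_right hn hnF h2 i (hβ i))
    exact ⟨ρ, h1, h1'⟩
  · intro ρ hρ l hl h
    have hA : ∀ j (b : ABlock F n r s α j),
        (∃ c, c * aeval ((ρ (qx F n)).1 j) (h.comp (X ^ l)) = b) ↔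
          b ∈ codeBlockA n r s f α l h j := fun j b => by
      refine (hρ.f_image j).exists_mul_eq_iff (hfg.f_irreducible j) (hfg.f_recip_irreducible j)
        (hα j) (hfg.left.root_ne_zero hn (Or.inl rfl) (hα j)) ?_ (D := delta n ≤ j.val) ?_ (h.comp (X ^ l)) b
      · intro hκ
        refine hfg.f_self j (lt_of_not_ge fun hj => hκ ?_)
        rw [kindA, if_neg (by have := hfg.delta_le; omega), if_neg (by omega)]
      · intro hκ
        refine le_of_not_gt fun hj => ?_
        rw [kindA, if_pos hj] at hκ
        exact BlockKind.noConfusion hκ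
    have hB : ∀ i (b : BBlock F n t k β i),
        (∃ c, c * aeval ((ρ (qx F n)).2 i) (h.comp (X ^ l)) = b) ↔
          b ∈ codeBlockB n t k g β l h i := fun i b => by
      refine (hρ.g_image i).exists_mul_eq_iff (hfg.g_irreducible i) (hfg.g_recip_irreducible i)
        (hβ i) (hfg.right.root_ne_zero hn (Or.inr rfl) (hβ i)) ?_ (D := mu n ≤ i.val) ?_ (h.comp (X ^ l)) b
      · intro hκ
        refine hfg.g_self i (lt_of_not_ge fun hi => hκ ?_)
        rw [kindB, if_neg (by have := hfg.mu_le; omega), if_neg (by omega)]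
      · intro hκ
        refine le_of_not_gt fun hi => ?_
        rw [kindB, if_pos hi] at hκ
        split_ifs at hκ
    set H := h.comp (X ^ l)
    have h1 : ∀ j, (aeval (ρ (qx F n)) H).1 j = aeval ((ρ (qx F n)).1 j) H := fun j =>
      (aeval_algHom_apply ((Pi.evalAlgHom F (ABlock F n r s α) j).comp (AlgHom.fst F _ _))
        (ρ (qx F n)) H).symm
    have h1' : ∀ i, (aeval (ρ (qx F n)) H).2 i = aeval ((ρ (qx F n)).2 i) H := fun i =>
      (aeval_algHom_apply ((Pi.evalAlgHom F (BBlock F n t k β) i).comp (AlgHom.snd F _ _))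
        (ρ (qx F n)) H).symm
    ext z
    rw [Submodule.mem_map, Submodule.mem_prod, Submodule.mem_pi, Submodule.mem_pi]
    simp only [Set.mem_univ, true_implies, ← hA, ← hB]
    constructor
    · rintro ⟨w, hw, rfl⟩
      rw [Submodule.restrictScalars_mem, inducedCode_eq_span, Ideal.mem_span_singleton'] at hw
      obtain ⟨c, rfl⟩ := hw
      have he : ρ (c * aeval (qx F n) H) = ρ c * aeval (ρ (qx F n)) H := by
        rw [map_mul, ← aeval_algHom_apply ρ]
      refine ⟨fun j => ⟨(ρ c).1 j, ?_⟩, fun i => ⟨(ρ c).2 i, ?_⟩⟩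
      · rw [← h1]
        exact (congrFun (congrArg Prod.fst he) j).symm
      · rw [← h1']
        exact (congrFun (congrArg Prod.snd he) i).symm
    · rintro ⟨hz, hz'⟩
      choose c hc using hz
      choose c' hc' using hz'
      -- The multipliers found block by block form one element of the product, and surjectivity of
      -- `ρ` lifts it to a single multiplier in the group algebra.
      refine ⟨ρ.symm (c, c') * aeval (qx F n) H, ?_, ?_⟩
      · rw [Submodule.restrictScalars_mem, inducedCode_eq_span, Ideal.mem_span_singleton']
        exact ⟨_, rfl⟩
      · have he : ρ (ρ.symm (c, c') * aeval (qx F n) H) = (c, c') * aeval (ρ (qx F n)) H := by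
          rw [map_mul, ρ.apply_symm_apply, ← aeval_algHom_apply ρ]
        refine he.trans (Prod.ext (funext fun j => ?_) (funext fun i => ?_))
        · rw [← hc, ← h1]
          rfl
        · rw [← hc', ← h1']
          rfl
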